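/- Let $(M,\eta)$ be a smooth pseudo-Riemannian manifold of dimension $m$ with Levi-Civita connection $\bar\nabla$, and let $\Sigma$ be an $n$-dimensional (immersed) submanifold of $M$, i.e. a smooth $n$-manifold with a smooth map $f:\Sigma\to M$, such that the induced metric $g=f^*\eta$ is nondegenerate; $T\Sigma$ is regarded as a subspace of $TM$. In local coordinates $x^1,\dots,x^m$ on $M$ and $u^1,\dots,u^n$ on $\Sigma$ write $f$ as $x^i(u^1,\dots,u^n)$, put $e_a=(\partial_ax^i)\partial_i$, $g_{ab}=\eta(e_a,e_b)$, and let $\bar\Gamma^i_{jk}$ be the Christoffel symbols of $\eta$. Indices $i,j,k,\dots$ are raised and lowered with $\eta$. Define along $\Sigma$ $$\mathcal D^{ij}=g^{ab}(\partial_ax^i)(\partial_bx^j),\qquad \mathcal D(X)=\mathcal D^{ij}\eta_{jk}X^k\partial_i,\qquad \Pi=1-\mathcal D,\qquad \hat\nabla_X=\bar\nabla_{\mathcal D(X)},\qquad \hat\nabla_j=\hat\nabla_{\partial_j}.$$ Let $\alpha(X,Y)$ denote the second fundamental form, i.e. the component of $\bar\nabla_XY$ that is $\eta$-orthogonal to $T\Sigma$.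 Then for all smooth vector fields $X,Y,Z,V$ tangent to $\Sigma$, at every point of $\Sigma$ and in all such local coordinates: 1. $\alpha(X,Y)^i=-(\hat\nabla_j\Pi^i{}_k)X^jY^k$; 2. $\eta(\alpha(X,Y),\alpha(Z,V))=(\hat\nabla_i\Pi_{rj})(\hat\nabla_k\Pi^r{}_l)X^iY^jZ^kV^l$; 3. $X^iY^j(\hat\nabla_i\mathcal D_{jk}-\hat\nabla_j\mathcal D_{ik})=0$ for every $k$. The tensor $\mathcal D$ agrees with the one defined by a bracket: let $\{\cdot,\dots,\cdot\}$ be an $(N+1)$-multilinear map on $C^\infty(\Sigma)$ that is a derivation in each argument, put $\mathcal P^{iI}=\frac1{\sqrt{N!}}\{x^i,x^{i_1},\dots,x^{i_N}\}$ for $I=(i_1,\dots,i_N)$ and $\eta_{IJ}=\eta_{i_1j_1}\cdots\eta_{i_Nj_N}$, and assume $\mathcal P^{iI}\mathcal P^{jJ}\eta_{IJ}=\epsilon\gamma^2g^{ab}(\partial_ax^i)(\partial_bx^j)$ with $\epsilon\in\{-1,1\}$ and $0<\gamma\in C^\infty(\Sigma)$. Then $\mathcal D^{ij}=\frac{\epsilon}{\gamma^2}\mathcal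 P^{iI}\mathcal P^{jJ}\eta_{IJ}$. -/

import Mathlib

open scoped Manifold ContDiff Topology Matrix

noncomputable section

namespace PseudoRiemannianSubmanifold

/-! ### Tensor calculus along a submanifold, in local coordinates

`h y` is the matrix `η_{ij}` of the ambient metric at the point with coordinates `y`, and
`x u = (x¹(u), …, xᵐ(u))` are the ambient coordinates of the point of the submanifold with
coordinates `u`. Tensor fields along the submanifold are given by their components with respect
to the ambient coordinates, as functions of `u`. -/

section Local

variable {m n : ℕ}

/-- The partial derivative `∂ₐ φ` at `u`. -/
def pderiv {d : ℕ} (a : Fin d) (φ : EuclideanSpace ℝ (Fin d) → ℝ) (u : EuclideanSpace ℝ (Fin d)) :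
    ℝ :=
  fderiv ℝ φ u (EuclideanSpace.single a 1)

/-- The Christoffel symbols `Γ̄ⁱ_{jk}` of the Levi-Civita connection of the metric `h`. -/
def christoffel (h : EuclideanSpace ℝ (Fin m) → Matrix (Fin m) (Fin m) ℝ) (i j k : Fin m)
    (y : EuclideanSpace ℝ (Fin m)) : ℝ :=
  (1 / 2) * ∑ l, (h y)⁻¹ i l *
    (pderiv j (fun z => h z l k) y + pderiv k (fun z => h z l j) y - pderiv l (fun z => h z j k) y)

/-- The matrix `∂ₐ xⁱ`; its columns are the tangent vectors `eₐ = (∂ₐ xⁱ) ∂ᵢ`. -/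
def frame (x : EuclideanSpace ℝ (Fin n) → EuclideanSpace ℝ (Fin m))
    (u : EuclideanSpace ℝ (Fin n)) : Matrix (Fin m) (Fin n) ℝ :=
  Matrix.of fun i a => pderiv a (fun v => x v i) u

variable (h : EuclideanSpace ℝ (Fin m) → Matrix (Fin m) (Fin m) ℝ)
  (x : EuclideanSpace ℝ (Fin n) → EuclideanSpace ℝ (Fin m))

/-- The induced metric `g_{ab} = η(eₐ, e_b)`. -/
def inducedMatrix (u : EuclideanSpace ℝ (Fin n)) : Matrix (Fin n) (Fin n) ℝ :=
  (frame x u)ᵀ * h (x u) * frame x u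

/-- `𝒟^{ij} = g^{ab} (∂ₐ xⁱ) (∂_b xʲ)`. -/
def projUp (u : EuclideanSpace ℝ (Fin n)) : Matrix (Fin m) (Fin m) ℝ :=
  frame x u * (inducedMatrix h x u)⁻¹ * (frame x u)ᵀ

/-- The mixed components `𝒟ⁱ_k = 𝒟^{ij} η_{jk}`, i.e. the matrix of `X ↦ 𝒟(X)`. -/
def projMixed (u : EuclideanSpace ℝ (Fin n)) : Matrix (Fin m) (Fin m) ℝ :=
  projUp h x u * h (x u)

/-- The lowered components `𝒟_{jk} = η_{jp} 𝒟^{pq} η_{qk}`. -/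
def projLow (u : EuclideanSpace ℝ (Fin n)) : Matrix (Fin m) (Fin m) ℝ :=
  h (x u) * projUp h x u * h (x u)

/-- `Πⁱ_k = δⁱ_k - 𝒟ⁱ_k`. -/
def normalMixed (u : EuclideanSpace ℝ (Fin n)) : Matrix (Fin m) (Fin m) ℝ :=
  1 - projMixed h x u

/-- `Π_{jk} = η_{ji} Πⁱ_k`. -/
def normalLow (u : EuclideanSpace ℝ (Fin n)) : Matrix (Fin m) (Fin m) ℝ :=
  h (x u) * normalMixed h x u

/-- The ambient components `wⁱ = wᵃ ∂ₐ xⁱ` of the tangent vector `wᵃ eₐ`. -/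
def pushVec (u : EuclideanSpace ℝ (Fin n)) (w : Fin n → ℝ) : Fin m → ℝ :=
  frame x u *ᵥ w

/-- The components of `𝒟(v)` with respect to the tangent frame `eₐ`: `g^{ab} (∂_b xʲ) η_{jk} vᵏ`. -/
def projCoord (u : EuclideanSpace ℝ (Fin n)) (v : Fin m → ℝ) : Fin n → ℝ :=
  ((inducedMatrix h x u)⁻¹ * (frame x u)ᵀ * h (x u)) *ᵥ v

theorem pushVec_projCoord (u : EuclideanSpace ℝ (Fin n)) (v : Fin m → ℝ) :
    pushVec x u (projCoord h x u v) = projMixed h x u *ᵥ v := by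
  simp [pushVec, projCoord, projMixed, projUp, Matrix.mulVec_mulVec, Matrix.mul_assoc]

/-- The derivative `wᵃ ∂ₐ φ` of a function on the submanifold along `w = wᵃ eₐ`. -/
def dirDeriv (w : Fin n → ℝ) (φ : EuclideanSpace ℝ (Fin n) → ℝ) (u : EuclideanSpace ℝ (Fin n)) :
    ℝ :=
  ∑ a, w a * pderiv a φ u

/-- `(∇̄_w Y)ⁱ` for an ambient vector field `Y` along the submanifold and a tangent vector
`w = wᵃ eₐ`. -/
def covVec (w : Fin n → ℝ) (Y : EuclideanSpace ℝ (Fin n) → Fin m → ℝ)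
    (u : EuclideanSpace ℝ (Fin n)) : Fin m → ℝ := fun i =>
  dirDeriv w (fun v => Y v i) u +
    ∑ l, ∑ p, christoffel h i l p (x u) * pushVec x u w l * Y u p

/-- `(∇̄_w T)ⁱ_k` for a tensor field `Tⁱ_k` along the submanifold. -/
def covMixed (w : Fin n → ℝ) (T : EuclideanSpace ℝ (Fin n) → Matrix (Fin m) (Fin m) ℝ)
    (u : EuclideanSpace ℝ (Fin n)) : Matrix (Fin m) (Fin m) ℝ := Matrix.of fun i k =>
  dirDeriv w (fun v => T v i k) u +
    ∑ l, ∑ p, christoffel h i l p (x u) * pushVec x u w l * T u p k -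
    ∑ l, ∑ p, christoffel h p l k (x u) * pushVec x u w l * T u i p

/-- `(∇̄_w T)_{jk}` for a tensor field `T_{jk}` along the submanifold. -/
def covLow (w : Fin n → ℝ) (T : EuclideanSpace ℝ (Fin n) → Matrix (Fin m) (Fin m) ℝ)
    (u : EuclideanSpace ℝ (Fin n)) : Matrix (Fin m) (Fin m) ℝ := Matrix.of fun j k =>
  dirDeriv w (fun v => T v j k) u -
    ∑ l, ∑ p, christoffel h p l j (x u) * pushVec x u w l * T u p k -
    ∑ l, ∑ p, christoffel h p l k (x u) * pushVec x u w l * T u j p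

/-- `∇̂_j Tⁱ_k`, where `∇̂_j = ∇̄_{𝒟(∂_j)}`. -/
def hatMixed (j : Fin m) (T : EuclideanSpace ℝ (Fin n) → Matrix (Fin m) (Fin m) ℝ)
    (u : EuclideanSpace ℝ (Fin n)) : Matrix (Fin m) (Fin m) ℝ :=
  covMixed h x (projCoord h x u (Pi.single j 1)) T u

/-- `∇̂_i T_{jk}`, where `∇̂_i = ∇̄_{𝒟(∂_i)}`. -/
def hatLow (i : Fin m) (T : EuclideanSpace ℝ (Fin n) → Matrix (Fin m) (Fin m) ℝ)
    (u : EuclideanSpace ℝ (Fin n)) : Matrix (Fin m) (Fin m) ℝ :=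
  covLow h x (projCoord h x u (Pi.single i 1)) T u

/-- The tangent space of the submanifold, as a subspace of the ambient tangent space. -/
def tangent (u : EuclideanSpace ℝ (Fin n)) : Submodule ℝ (Fin m → ℝ) :=
  LinearMap.range (Matrix.mulVecLin (frame x u))

/-- The normal space: all vectors that are `η`-orthogonal to the tangent space. -/
def normal (u : EuclideanSpace ℝ (Fin n)) : Submodule ℝ (Fin m → ℝ) :=
  (Matrix.toBilin' (h (x u))).orthogonal (tangent x u)

theorem isCompl_tangent_normal (u : EuclideanSpace ℝ (Fin n)) (hs : (h (x u)).IsSymm)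
    (hg : IsUnit (inducedMatrix h x u).det) : IsCompl (tangent x u) (normal h x u) := by
  have hrefl : (Matrix.toBilin' (h (x u))).IsRefl := by
    intro v w hvw
    rw [Matrix.toBilin'_apply'] at hvw ⊢
    rw [Matrix.dotProduct_mulVec, ← Matrix.mulVec_transpose, hs.eq, dotProduct_comm]
    exact hvw
  refine (LinearMap.BilinForm.isCompl_orthogonal_iff_disjoint hrefl).2 ?_
  rw [Submodule.disjoint_def]
  rintro _ ⟨w, rfl⟩ hw
  have key : inducedMatrix h x u *ᵥ w = 0 := by
    funext a
    have := hw (Matrix.mulVecLin (frame x u) (Pi.single a 1)) ⟨_, rfl⟩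
    rw [Matrix.toBilin'_apply'] at this
    simp only [Matrix.mulVecLin_apply, Matrix.mulVec_single_one] at this
    rw [inducedMatrix, Matrix.mul_assoc, ← Matrix.mulVec_mulVec, ← Matrix.mulVec_mulVec]
    exact this
  have hw0 : w = 0 := by
    have hu := (Matrix.isUnit_iff_isUnit_det _).2 hg
    exact Matrix.mulVec_injective_of_isUnit hu (by simpa using key)
  simp [hw0]

open Classical in
/-- The normal component of an ambient vector `v`, i.e. its component in the normal space with
respect to the decomposition of the ambient tangent space into tangent and normal space (which
exists when the induced metric is nondegenerate, see `isCompl_tangent_normal`). -/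
def normalPart (u : EuclideanSpace ℝ (Fin n)) (v : Fin m → ℝ) : Fin m → ℝ :=
  if hc : IsCompl (normal h x u) (tangent x u) then
    (normal h x u).projection (tangent x u) hc v
  else 0

/-- The second fundamental form `α(X, Y)ⁱ`: the normal component of `∇̄_X Y`, where `X = Xᵃ eₐ`
and `Y = Yᵃ eₐ`. -/
def secondFundamentalForm (X Y : EuclideanSpace ℝ (Fin n) → Fin n → ℝ)
    (u : EuclideanSpace ℝ (Fin n)) : Fin m → ℝ :=
  normalPart h x u (covVec h x (X u) (fun v => pushVec x v (Y v)) u)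

end Local

/-! ### Pseudo-Riemannian manifolds and their submanifolds -/

/-- The coordinate vector field `∂ᵢ` of the chart `e`, at the point with coordinates `y`. -/
def coordVec {m : ℕ} {M : Type*} [TopologicalSpace M] [ChartedSpace (EuclideanSpace ℝ (Fin m)) M]
    (e : OpenPartialHomeomorph M (EuclideanSpace ℝ (Fin m))) (i : Fin m)
    (y : EuclideanSpace ℝ (Fin m)) : TangentSpace (𝓡 m) (e.symm y) :=
  mfderiv (𝓡 m) (𝓡 m) e.symm y (EuclideanSpace.single i (1 : ℝ))

/-- A smooth pseudo-Riemannian metric on an `m`-dimensional manifold: a nondegenerate symmetric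
bilinear form on each tangent space whose components in every chart are smooth. -/
structure PseudoRiemannianMetric (m : ℕ) (M : Type*) [TopologicalSpace M]
    [ChartedSpace (EuclideanSpace ℝ (Fin m)) M] where
  form : ∀ p : M, LinearMap.BilinForm ℝ (TangentSpace (𝓡 m) p)
  symm : ∀ p, (form p).IsSymm
  nondegenerate : ∀ p, (form p).Nondegenerate
  smooth : ∀ e ∈ IsManifold.maximalAtlas (𝓡 m) ∞ M, ∀ i j : Fin m,
    ContDiffOn ℝ ∞ (fun y => form (e.symm y) (coordVec e i y) (coordVec e j y)) e.target

section Global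

variable {m n : ℕ} {M S : Type*}
  [TopologicalSpace M] [ChartedSpace (EuclideanSpace ℝ (Fin m)) M]
  [TopologicalSpace S] [ChartedSpace (EuclideanSpace ℝ (Fin n)) S]

/-- The components `η_{ij}` of the metric in the chart `e`. -/
def PseudoRiemannianMetric.comp (η : PseudoRiemannianMetric m M)
    (e : OpenPartialHomeomorph M (EuclideanSpace ℝ (Fin m))) (y : EuclideanSpace ℝ (Fin m)) :
    Matrix (Fin m) (Fin m) ℝ :=
  Matrix.of fun i j => η.form (e.symm y) (coordVec e i y) (coordVec e j y)

/-- The metric induced on `S` by a map `f : S → M`. -/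
def PseudoRiemannianMetric.induced (η : PseudoRiemannianMetric m M) (f : S → M) (p : S) :
    LinearMap.BilinForm ℝ (TangentSpace (𝓡 n) p) :=
  (η.form (f p)).compl₁₂ (mfderiv (𝓡 n) (𝓡 m) f p).toLinearMap
    (mfderiv (𝓡 n) (𝓡 m) f p).toLinearMap

/-- The coordinate expression `xⁱ(u¹, …, uⁿ)` of `f : S → M`. -/
def coordExpr (f : S → M) (e : OpenPartialHomeomorph M (EuclideanSpace ℝ (Fin m)))
    (c : OpenPartialHomeomorph S (EuclideanSpace ℝ (Fin n))) (u : EuclideanSpace ℝ (Fin n)) :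
    EuclideanSpace ℝ (Fin m) :=
  e (f (c.symm u))

/-- The components `Xᵃ(u)` in the chart `c` of a vector field `X` on `S`. -/
def coordComp (c : OpenPartialHomeomorph S (EuclideanSpace ℝ (Fin n)))
    (X : ∀ p : S, TangentSpace (𝓡 n) p) (u : EuclideanSpace ℝ (Fin n)) : Fin n → ℝ := fun a =>
  (show EuclideanSpace ℝ (Fin n) from mfderiv (𝓡 n) (𝓡 n) c (c.symm u) (X (c.symm u))) a

/-! ### Multilinear brackets -/

/-- An `(N+1)`-ary multilinear bracket on `C^∞(S)` that is a derivation in each argument. -/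
structure DerivationBracket (N n : ℕ) (S : Type*) [TopologicalSpace S]
    [ChartedSpace (EuclideanSpace ℝ (Fin n)) S] where
  toMap : MultilinearMap ℝ (fun _ : Fin (N + 1) => C^∞⟮𝓡 n, S; ℝ⟯) C^∞⟮𝓡 n, S; ℝ⟯
  leibniz : ∀ (F : Fin (N + 1) → C^∞⟮𝓡 n, S; ℝ⟯) (k : Fin (N + 1)) (φ ψ : C^∞⟮𝓡 n, S; ℝ⟯),
    toMap (Function.update F k (φ * ψ)) =
      φ * toMap (Function.update F k ψ) + ψ * toMap (Function.update F k φ)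

/-- `P^{iI} P^{jJ} η_{IJ}` at `p`, where `P^{iI} = {xⁱ, x^{i₁}, …, x^{i_N}} / √(N!)`; here `F` are
the coordinate functions `xⁱ` on `S` and `H` is the matrix `η_{ij}` at `p`. -/
def DerivationBracket.square {N : ℕ} (B : DerivationBracket N n S) (F : Fin m → C^∞⟮𝓡 n, S; ℝ⟯)
    (H : Matrix (Fin m) (Fin m) ℝ) (p : S) (i j : Fin m) : ℝ :=
  ∑ I : Fin N → Fin m, ∑ J : Fin N → Fin m,
    ((1 / Real.sqrt (N.factorial : ℝ)) * B.toMap (Matrix.vecCons (F i) fun r => F (I r)) p) *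
    ((1 / Real.sqrt (N.factorial : ℝ)) * B.toMap (Matrix.vecCons (F j) fun r => F (J r)) p) *
    ∏ r, H (I r) (J r)

/-- The compatibility `P^{iI} P^{jJ} η_{IJ} = ε γ² g^{ab} (∂ₐ xⁱ) (∂_b xʲ)` of a bracket with the
metric, in all local coordinates. Since coordinate functions are only defined locally, it is
required for all smooth functions on `S` that agree with the coordinate functions near the point
(a bracket that is a derivation in each argument depends only on germs). -/
def DerivationBracket.Compatible {N : ℕ} (B : DerivationBracket N n S)
    (η : PseudoRiemannianMetric m M) (f : S → M) (ε : ℝ) (γ : C^∞⟮𝓡 n, S; ℝ⟯) : Prop :=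
  ∀ e ∈ IsManifold.maximalAtlas (𝓡 m) ∞ M, ∀ c ∈ IsManifold.maximalAtlas (𝓡 n) ∞ S,
  ∀ u ∈ c.target, f (c.symm u) ∈ e.source → ∀ F : Fin m → C^∞⟮𝓡 n, S; ℝ⟯,
    (∀ᶠ q in 𝓝 (c.symm u), ∀ i, F i q = e (f q) i) → ∀ i j,
      B.square F (η.comp e (coordExpr f e c u)) (c.symm u) i j =
        ε * γ (c.symm u) ^ 2 * projUp (η.comp e) (coordExpr f e c) u i j

end Global

end PseudoRiemannianSubmanifold

end

open PseudoRiemannianSubmanifold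

open scoped Manifold ContDiff Topology Matrix

noncomputable section

namespace PseudoRiemannianSubmanifold

/-! ### Derivatives of matrix-valued functions -/

section Deriv

variable {d : ℕ} {w : Fin d → ℝ} {u : EuclideanSpace ℝ (Fin d)}

/-! In a pair of charts everything becomes matrix calculus. Let `E` be the frame, `h` the ambient
metric, `g = Eᵀ h E`, `D = E g⁻¹ Eᵀ h` and `Π = 1 - D`. Then `D E = E` and `Eᵀ h Π = 0`, so `Π` is
the projection onto the normal space along the tangent space (`normalPart_eq`).

Since `det g ≠ 0` is an open condition, `Π E = 0` holds near the point and may be differentiated: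
`(∇̄_w Π) E = -Π (∇̄_w E)` (`covMixed_normalMixed_mul_frame`). For a tangent field `E Y`, the
derivative of the coefficients `Y` contributes a tangent vector, which `Π` kills, so `α(X, Y) = Π
∇̄_X (E Y) = -(∇̄_X Π) E Y` (`secondFundamentalForm_eq`). Contracting `∇̂_j` with a tangent `X`
gives `∇̄_X` because `D X = X` (`sum_smul_hatMixed`, `sum_smul_hatLow`); this is formula 1.

Formula 2 multiplies two copies of formula 1 and lowers an index inside the derivative, using `∇̄η =
0` (`covLow_metric_mul`). Formula 3 is the symmetry of `(∇̄_X Π) Y` in tangent `X`, `Y`, which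
follows from vanishing torsion and equality of mixed partials (`covMixed_normalMixed_mulVec_comm`),
together with `∇̄D = -∇̄Π` and the symmetry of the lowered `D`. The bracket formula is the
compatibility assumption solved for `D`, using `ε² = 1`. -/

theorem dirDeriv_eq_fderiv (w : Fin d → ℝ) (φ : EuclideanSpace ℝ (Fin d) → ℝ)
    (u : EuclideanSpace ℝ (Fin d)) : dirDeriv w φ u = fderiv ℝ φ u (WithLp.toLp 2 w) := by
  have hw : WithLp.toLp 2 w = ∑ a, w a • EuclideanSpace.single a (1 : ℝ) := by
    ext b
    simp [Finset.sum_apply, Pi.single_apply]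
  simp [hw, dirDeriv, pderiv]

theorem dirDeriv_mul {φ ψ : EuclideanSpace ℝ (Fin d) → ℝ} (hφ : DifferentiableAt ℝ φ u)
    (hψ : DifferentiableAt ℝ ψ u) :
    dirDeriv w (fun v => φ v * ψ v) u = dirDeriv w φ u * ψ u + φ u * dirDeriv w ψ u := by
  simp only [dirDeriv_eq_fderiv, fderiv_fun_mul hφ hψ]
  simp
  ring

theorem dirDeriv_sum {ι : Type*} {s : Finset ι} {φ : ι → EuclideanSpace ℝ (Fin d) → ℝ}
    (hφ : ∀ i ∈ s, DifferentiableAt ℝ (φ i) u) :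
    dirDeriv w (fun v => ∑ i ∈ s, φ i v) u = ∑ i ∈ s, dirDeriv w (φ i) u := by
  simp only [dirDeriv_eq_fderiv, fderiv_fun_sum hφ]
  simp

theorem dirDeriv_congr {φ ψ : EuclideanSpace ℝ (Fin d) → ℝ} (hφ : φ =ᶠ[𝓝 u] ψ) :
    dirDeriv w φ u = dirDeriv w ψ u := by
  simp only [dirDeriv_eq_fderiv, hφ.fderiv_eq]

/-- The entrywise derivative of a matrix-valued function along `w`. -/
def dirMat {p q : Type*} (w : Fin d → ℝ) (T : EuclideanSpace ℝ (Fin d) → Matrix p q ℝ)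
    (u : EuclideanSpace ℝ (Fin d)) : Matrix p q ℝ :=
  Matrix.of fun i k => dirDeriv w (fun v => T v i k) u

variable {p q r : Type*}

theorem dirMat_congr {T T' : EuclideanSpace ℝ (Fin d) → Matrix p q ℝ} (hT : T =ᶠ[𝓝 u] T') :
    dirMat w T u = dirMat w T' u := by
  ext i k
  exact dirDeriv_congr (hT.mono fun v hv => by simp only [hv])

theorem dirMat_const (T : Matrix p q ℝ) : dirMat w (fun _ => T) u = 0 := by
  ext i k
  simp [dirMat, dirDeriv_eq_fderiv]

theorem dirMat_const_sub (C : Matrix p q ℝ) (T : EuclideanSpace ℝ (Fin d) → Matrix p q ℝ) :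
    dirMat w (fun v => C - T v) u = -dirMat w T u := by
  ext i k
  simp [dirMat, dirDeriv_eq_fderiv, fderiv_const_sub]

variable [Fintype q]

theorem differentiableAt_mul_entry {A : EuclideanSpace ℝ (Fin d) → Matrix p q ℝ}
    {B : EuclideanSpace ℝ (Fin d) → Matrix q r ℝ}
    (hA : ∀ i j, DifferentiableAt ℝ (fun v => A v i j) u)
    (hB : ∀ i j, DifferentiableAt ℝ (fun v => B v i j) u) (i : p) (j : r) :
    DifferentiableAt ℝ (fun v => (A v * B v) i j) u := by
  simp only [Matrix.mul_apply]
  exact DifferentiableAt.fun_sum fun k _ => (hA i k).mul (hB k j)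

theorem dirMat_mul {A : EuclideanSpace ℝ (Fin d) → Matrix p q ℝ}
    {B : EuclideanSpace ℝ (Fin d) → Matrix q r ℝ}
    (hA : ∀ i j, DifferentiableAt ℝ (fun v => A v i j) u)
    (hB : ∀ i j, DifferentiableAt ℝ (fun v => B v i j) u) :
    dirMat w (fun v => A v * B v) u = dirMat w A u * B u + A u * dirMat w B u := by
  ext i j
  simp only [dirMat, Matrix.mul_apply, Matrix.of_apply, Matrix.add_apply]
  rw [dirDeriv_sum fun k _ => (hA i k).fun_mul (hB k j), ← Finset.sum_add_distrib]
  exact Finset.sum_congr rfl fun k _ => dirDeriv_mul (hA i k) (hB k j)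

theorem dirDeriv_mulVec {A : EuclideanSpace ℝ (Fin d) → Matrix p q ℝ}
    {B : EuclideanSpace ℝ (Fin d) → q → ℝ}
    (hA : ∀ i j, DifferentiableAt ℝ (fun v => A v i j) u)
    (hB : ∀ j, DifferentiableAt ℝ (fun v => B v j) u) (i : p) :
    dirDeriv w (fun v => (A v *ᵥ B v) i) u =
      (dirMat w A u *ᵥ B u) i + (A u *ᵥ fun j => dirDeriv w (fun v => B v j) u) i := by
  simp only [dirMat, Matrix.mulVec, dotProduct, Matrix.of_apply]
  rw [dirDeriv_sum fun k _ => (hA i k).fun_mul (hB k), ← Finset.sum_add_distrib]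
  exact Finset.sum_congr rfl fun k _ => dirDeriv_mul (hA i k) (hB k)

variable [DecidableEq q]

theorem differentiableAt_det {A : EuclideanSpace ℝ (Fin d) → Matrix q q ℝ}
    (hA : ∀ i j, DifferentiableAt ℝ (fun v => A v i j) u) :
    DifferentiableAt ℝ (fun v => (A v).det) u := by
  simp only [Matrix.det_apply']
  exact DifferentiableAt.fun_sum fun σ _ =>
    (HasFDerivAt.finsetProd fun i _ => (hA (σ i) i).hasFDerivAt).differentiableAt.const_mul _

/-- Cramer's rule: the inverse is the adjugate divided by the determinant, and both are built from
determinants. -/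
theorem differentiableAt_inv_entry {A : EuclideanSpace ℝ (Fin d) → Matrix q q ℝ}
    (hA : ∀ i j, DifferentiableAt ℝ (fun v => A v i j) u) (hu : IsUnit (A u).det) (i j : q) :
    DifferentiableAt ℝ (fun v => (A v)⁻¹ i j) u := by
  simp only [Matrix.inv_def, Matrix.smul_apply, Ring.inverse_eq_inv', smul_eq_mul]
  refine ((differentiableAt_det hA).inv hu.ne_zero).mul ?_
  simp only [Matrix.adjugate_apply]
  refine differentiableAt_det fun k l => ?_
  -- Row `j` has been replaced by a constant basis vector; the other rows are those of `A`.
  by_cases hk : k = j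
  · subst hk
    simp
  · simpa [Matrix.updateRow_ne hk] using hA k l

end Deriv

/-! ### The connection matrix -/

section Conn

variable {m n : ℕ} {h : EuclideanSpace ℝ (Fin m) → Matrix (Fin m) (Fin m) ℝ}
  {x : EuclideanSpace ℝ (Fin n) → EuclideanSpace ℝ (Fin m)} {u : EuclideanSpace ℝ (Fin n)}

/-- The matrix `Γ̄ⁱ_{lp} wˡ` of the connection along the tangent vector `w`. -/
def connMat (h : EuclideanSpace ℝ (Fin m) → Matrix (Fin m) (Fin m) ℝ)
    (x : EuclideanSpace ℝ (Fin n) → EuclideanSpace ℝ (Fin m)) (u : EuclideanSpace ℝ (Fin n))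
    (w : Fin n → ℝ) : Matrix (Fin m) (Fin m) ℝ :=
  Matrix.of fun i p => ∑ l, christoffel h i l p (x u) * pushVec x u w l

/-- With the index sums packed into `connMat`, this and the next two identities reduce later
computations to noncommutative algebra. -/
theorem covVec_eq (w : Fin n → ℝ) (Y : EuclideanSpace ℝ (Fin n) → Fin m → ℝ) :
    covVec h x w Y u = (fun i => dirDeriv w (fun v => Y v i) u) + connMat h x u w *ᵥ Y u := by
  ext i
  simp only [covVec, connMat, Pi.add_apply, Matrix.mulVec, dotProduct, Matrix.of_apply,
    Finset.sum_mul]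
  rw [Finset.sum_comm]

theorem covMixed_eq (w : Fin n → ℝ) (T : EuclideanSpace ℝ (Fin n) → Matrix (Fin m) (Fin m) ℝ) :
    covMixed h x w T u = dirMat w T u + connMat h x u w * T u - T u * connMat h x u w := by
  ext i k
  simp only [covMixed, connMat, dirMat, Matrix.add_apply, Matrix.sub_apply, Matrix.mul_apply,
    Matrix.of_apply, Finset.sum_mul, Finset.mul_sum]
  congr 1
  · congr 1
    rw [Finset.sum_comm]
  · rw [Finset.sum_comm]
    exact Finset.sum_congr rfl fun p _ => Finset.sum_congr rfl fun l _ => by ring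

theorem covLow_eq (w : Fin n → ℝ) (T : EuclideanSpace ℝ (Fin n) → Matrix (Fin m) (Fin m) ℝ) :
    covLow h x w T u = dirMat w T u - (connMat h x u w)ᵀ * T u - T u * connMat h x u w := by
  ext i k
  simp only [covLow, connMat, dirMat, Matrix.sub_apply, Matrix.mul_apply, Matrix.transpose_apply,
    Matrix.of_apply, Finset.sum_mul, Finset.mul_sum]
  congr 1
  · congr 1
    rw [Finset.sum_comm]
  · rw [Finset.sum_comm]
    exact Finset.sum_congr rfl fun p _ => Finset.sum_congr rfl fun l _ => by ring

/-! ### Torsion-freeness and metric compatibility -/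

theorem christoffel_symm (hs : ∀ y, (h y).IsSymm) (i j k : Fin m) (y : EuclideanSpace ℝ (Fin m)) :
    christoffel h i j k y = christoffel h i k j y := by
  have hjk : (fun z => h z j k) = fun z => h z k j := by
    funext z
    exact (hs z).apply k j
  simp only [christoffel]
  congr 1
  refine Finset.sum_congr rfl fun l _ => ?_
  rw [hjk]
  ring

theorem sum_metric_mul_christoffel {y : EuclideanSpace ℝ (Fin m)} (hd : IsUnit (h y).det)
    (i j k : Fin m) :
    ∑ p, h y i p * christoffel h p j k y =
      (1 / 2) * (pderiv j (fun z => h z i k) y + pderiv k (fun z => h z i j) y -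
        pderiv i (fun z => h z j k) y) := by
  set c : Fin m → ℝ := fun l => pderiv j (fun z => h z l k) y + pderiv k (fun z => h z l j) y -
    pderiv l (fun z => h z j k) y with hc
  have key : h y *ᵥ ((h y)⁻¹ *ᵥ c) = c := by
    rw [Matrix.mulVec_mulVec, Matrix.mul_nonsing_inv _ hd, Matrix.one_mulVec]
  have := congrFun key i
  simp only [Matrix.mulVec, dotProduct] at this
  rw [show (1 / 2) * (pderiv j (fun z => h z i k) y + pderiv k (fun z => h z i j) y -
    pderiv i (fun z => h z j k) y) = (1 / 2) * c i from rfl, ← this, Finset.mul_sum]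
  refine Finset.sum_congr rfl fun p _ => ?_
  simp only [christoffel, hc]
  ring

/-- In the sum of the two Christoffel symbols of the first kind, four of the six derivatives of the
metric cancel in pairs and the other two coincide. -/
theorem pderiv_metric {y : EuclideanSpace ℝ (Fin m)} (hs : ∀ y, (h y).IsSymm)
    (hd : IsUnit (h y).det) (l j k : Fin m) :
    pderiv l (fun z => h z j k) y =
      ∑ p, christoffel h p l j y * h y p k + ∑ p, h y j p * christoffel h p l k y := by
  have e1 : ∑ p, christoffel h p l j y * h y p k = ∑ p, h y k p * christoffel h p l j y :=
    Finset.sum_congr rfl fun p _ => by rw [(hs y).apply k p, mul_comm]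
  have sw : ∀ a b, (fun z => h z a b) = fun z => h z b a := fun a b => by
    funext z
    exact (hs z).apply b a
  rw [e1, sum_metric_mul_christoffel hd, sum_metric_mul_christoffel hd, sw k j, sw k l, sw j l]
  ring

theorem dirDeriv_comp {φ : EuclideanSpace ℝ (Fin m) → ℝ} (w : Fin n → ℝ)
    (hφ : DifferentiableAt ℝ φ (x u)) (hx : DifferentiableAt ℝ x u) :
    dirDeriv w (fun v => φ (x v)) u = ∑ l, pushVec x u w l * pderiv l φ (x u) := by
  have hp : WithLp.toLp 2 (pushVec x u w) = fderiv ℝ x u (WithLp.toLp 2 w) := by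
    ext l
    have h1 : fderiv ℝ (fun v => x v l) u = (EuclideanSpace.proj l).comp (fderiv ℝ x u) :=
      ((EuclideanSpace.proj (𝕜 := ℝ) l).hasFDerivAt.comp u hx.hasFDerivAt).fderiv
    have h2 := dirDeriv_eq_fderiv w (fun v => x v l) u
    rw [h1] at h2
    simp only [dirDeriv] at h2
    simp only [pushVec, Matrix.mulVec, dotProduct, frame, Matrix.of_apply]
    simpa [mul_comm] using h2
  have h3 : fderiv ℝ (fun v => φ (x v)) u = (fderiv ℝ φ (x u)).comp (fderiv ℝ x u) :=
    fderiv_comp u hφ hx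
  rw [dirDeriv_eq_fderiv, h3, ContinuousLinearMap.comp_apply, ← hp, ← dirDeriv_eq_fderiv, dirDeriv]

/-- This is `∇̄_w η = 0` along the submanifold: the chain rule applied to `pderiv_metric`. -/
theorem dirMat_metric (hs : ∀ y, (h y).IsSymm) (hd : IsUnit (h (x u)).det)
    (hh : ∀ i j, DifferentiableAt ℝ (fun y => h y i j) (x u)) (hx : DifferentiableAt ℝ x u)
    (w : Fin n → ℝ) :
    dirMat w (fun v => h (x v)) u =
      (connMat h x u w)ᵀ * h (x u) + h (x u) * connMat h x u w := by
  ext j k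
  simp only [dirMat, connMat, Matrix.of_apply, Matrix.add_apply, Matrix.mul_apply,
    Matrix.transpose_apply]
  rw [dirDeriv_comp (φ := fun y => h y j k) w (hh j k) hx]
  simp only [pderiv_metric hs hd, mul_add, Finset.sum_add_distrib, Finset.mul_sum, Finset.sum_mul]
  congr 1
  · rw [Finset.sum_comm]
    exact Finset.sum_congr rfl fun p _ => Finset.sum_congr rfl fun l _ => by ring
  · rw [Finset.sum_comm]
    exact Finset.sum_congr rfl fun p _ => Finset.sum_congr rfl fun l _ => by ring

/-- Lowering an index commutes with the covariant derivative. -/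
theorem covLow_metric_mul (hs : ∀ y, (h y).IsSymm) (hd : IsUnit (h (x u)).det)
    (hh : ∀ i j, DifferentiableAt ℝ (fun y => h y i j) (x u)) (hx : DifferentiableAt ℝ x u)
    {T : EuclideanSpace ℝ (Fin n) → Matrix (Fin m) (Fin m) ℝ}
    (hT : ∀ i j, DifferentiableAt ℝ (fun v => T v i j) u) (w : Fin n → ℝ) :
    covLow h x w (fun v => h (x v) * T v) u = h (x u) * covMixed h x w T u := by
  rw [covLow_eq, covMixed_eq, dirMat_mul (A := fun v => h (x v)) (fun i j => (hh i j).comp u hx) hT,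
    dirMat_metric hs hd hh hx]
  noncomm_ring

theorem connMat_mulVec_pushVec_comm (hs : ∀ y, (h y).IsSymm) (w v : Fin n → ℝ) :
    connMat h x u w *ᵥ pushVec x u v = connMat h x u v *ᵥ pushVec x u w := by
  ext i
  simp only [connMat, Matrix.mulVec, dotProduct, Matrix.of_apply, Finset.sum_mul]
  rw [Finset.sum_comm]
  refine Finset.sum_congr rfl fun p _ => Finset.sum_congr rfl fun l _ => ?_
  rw [christoffel_symm hs i p l]
  ring

/-! ### Second derivatives of the parametrization, and regularity -/

/-- Both sides are the second derivative of `x` evaluated on `w` and `v`, which is symmetric for a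
`C²` map. -/
theorem dirMat_frame_mulVec_comm (hx : ContDiffAt ℝ 2 x u) (w v : Fin n → ℝ) :
    dirMat w (frame x) u *ᵥ v = dirMat v (frame x) u *ᵥ w := by
  ext i
  have hxi : ContDiffAt ℝ 2 (fun v => x v i) u := by fun_prop
  have hsym : IsSymmSndFDerivAt ℝ (fun v => x v i) u := hxi.isSymmSndFDerivAt (by simp)
  have hdf : DifferentiableAt ℝ (fderiv ℝ (fun v => x v i)) u :=
    (hxi.fderiv_right (m := 1) (by norm_num)).differentiableAt (by norm_num)
  have hp : ∀ a b, pderiv b (fun v => pderiv a (fun v => x v i) v) u =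
      fderiv ℝ (fderiv ℝ (fun v => x v i)) u (EuclideanSpace.single b 1)
        (EuclideanSpace.single a 1) := by
    intro a b
    simp only [pderiv]
    rw [fderiv_clm_apply hdf (by fun_prop)]
    simp
  simp only [dirMat, Matrix.mulVec, dotProduct, Matrix.of_apply, frame, dirDeriv, hp,
    Finset.sum_mul]
  rw [Finset.sum_comm]
  refine Finset.sum_congr rfl fun a _ => Finset.sum_congr rfl fun b _ => ?_
  rw [hsym.eq]
  ring

theorem differentiableAt_frame (hx : ContDiffAt ℝ 2 x u) (i : Fin m) (a : Fin n) :
    DifferentiableAt ℝ (fun v => frame x v i a) u := by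
  have hxi : ContDiffAt ℝ 2 (fun v => x v i) u := by fun_prop
  have hdf : DifferentiableAt ℝ (fderiv ℝ (fun v => x v i)) u :=
    (hxi.fderiv_right (m := 1) (by norm_num)).differentiableAt (by norm_num)
  simp only [frame, Matrix.of_apply, pderiv]
  fun_prop

theorem differentiableAt_inducedMatrix (hx : ContDiffAt ℝ 2 x u)
    (hh : ∀ i j, DifferentiableAt ℝ (fun y => h y i j) (x u)) (a b : Fin n) :
    DifferentiableAt ℝ (fun v => inducedMatrix h x v a b) u :=
  differentiableAt_mul_entry (differentiableAt_mul_entry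
      (A := fun v => (frame x v)ᵀ) (B := fun v => h (x v))
      (fun a i => differentiableAt_frame hx i a)
      fun i j => (hh i j).comp u (hx.differentiableAt (by norm_num)))
    (differentiableAt_frame hx) a b

theorem differentiableAt_projMixed (hx : ContDiffAt ℝ 2 x u)
    (hh : ∀ i j, DifferentiableAt ℝ (fun y => h y i j) (x u))
    (hg : IsUnit (inducedMatrix h x u).det) (i j : Fin m) :
    DifferentiableAt ℝ (fun v => projMixed h x v i j) u :=
  differentiableAt_mul_entry (A := projUp h x) (B := fun v => h (x v))
    (differentiableAt_mul_entry (B := fun v => (frame x v)ᵀ)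
      (differentiableAt_mul_entry (differentiableAt_frame hx)
        (differentiableAt_inv_entry (differentiableAt_inducedMatrix hx hh) hg))
      fun a i => differentiableAt_frame hx i a)
    (fun i j => (hh i j).comp u (hx.differentiableAt (by norm_num))) i j

theorem differentiableAt_normalMixed (hx : ContDiffAt ℝ 2 x u)
    (hh : ∀ i j, DifferentiableAt ℝ (fun y => h y i j) (x u))
    (hg : IsUnit (inducedMatrix h x u).det) (i j : Fin m) :
    DifferentiableAt ℝ (fun v => normalMixed h x v i j) u := by
  simp only [normalMixed, Matrix.sub_apply]
  exact (differentiableAt_projMixed hx hh hg i j).const_sub _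

/-! ### Algebra of the tangential and normal projections -/

theorem projMixed_mul_frame (hg : IsUnit (inducedMatrix h x u).det) :
    projMixed h x u * frame x u = frame x u := by
  have : projMixed h x u * frame x u =
      frame x u * ((inducedMatrix h x u)⁻¹ * inducedMatrix h x u) := by
    simp only [projMixed, projUp, inducedMatrix, Matrix.mul_assoc]
  rw [this, Matrix.nonsing_inv_mul _ hg, Matrix.mul_one]

theorem normalMixed_mul_frame (hg : IsUnit (inducedMatrix h x u).det) :
    normalMixed h x u * frame x u = 0 := by
  rw [normalMixed, Matrix.sub_mul, projMixed_mul_frame hg, Matrix.one_mul, sub_self]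

theorem projCoord_pushVec (hg : IsUnit (inducedMatrix h x u).det) (w : Fin n → ℝ) :
    projCoord h x u (pushVec x u w) = w := by
  have : projCoord h x u (pushVec x u w) =
      ((inducedMatrix h x u)⁻¹ * inducedMatrix h x u) *ᵥ w := by
    simp only [projCoord, pushVec, Matrix.mulVec_mulVec, inducedMatrix, Matrix.mul_assoc]
  rw [this, Matrix.nonsing_inv_mul _ hg, Matrix.one_mulVec]

theorem inducedMatrix_isSymm (hs : (h (x u)).IsSymm) : (inducedMatrix h x u).IsSymm := by
  simp only [Matrix.IsSymm, inducedMatrix, Matrix.transpose_mul, Matrix.transpose_transpose, hs.eq,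
    Matrix.mul_assoc]

theorem projUp_isSymm (hs : (h (x u)).IsSymm) : (projUp h x u).IsSymm := by
  simp only [Matrix.IsSymm, projUp, Matrix.transpose_mul, Matrix.transpose_transpose,
    Matrix.transpose_nonsing_inv, (inducedMatrix_isSymm hs).eq, Matrix.mul_assoc]

theorem projLow_isSymm (hs : (h (x u)).IsSymm) : (projLow h x u).IsSymm := by
  simp only [Matrix.IsSymm, projLow, Matrix.transpose_mul, (projUp_isSymm hs).eq, hs.eq,
    Matrix.mul_assoc]

/-- Writing `v = Π v + D v` exhibits a normal and a tangent summand; uniqueness of the decomposition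
identifies the first one. -/
theorem normalPart_eq (hs : (h (x u)).IsSymm) (hg : IsUnit (inducedMatrix h x u).det)
    (v : Fin m → ℝ) : normalPart h x u v = normalMixed h x u *ᵥ v := by
  have hc := (isCompl_tangent_normal h x u hs hg).symm
  have hn : normalMixed h x u *ᵥ v ∈ normal h x u := by
    rintro _ ⟨w, rfl⟩
    change (Matrix.toBilin' (h (x u))) _ _ = 0
    -- Orthogonality to all tangent vectors at once: `Eᵀ h D = g g⁻¹ Eᵀ h = Eᵀ h`.
    have h0 : (frame x u)ᵀ * h (x u) * normalMixed h x u = 0 := by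
      have : (frame x u)ᵀ * h (x u) * projMixed h x u =
          inducedMatrix h x u * (inducedMatrix h x u)⁻¹ * ((frame x u)ᵀ * h (x u)) := by
        simp only [projMixed, projUp, inducedMatrix, Matrix.mul_assoc]
      rw [normalMixed, Matrix.mul_sub, this, Matrix.mul_nonsing_inv _ hg, Matrix.one_mul,
        Matrix.mul_one, sub_self]
    rw [Matrix.toBilin'_apply', Matrix.mulVecLin_apply, dotProduct_comm, Matrix.dotProduct_mulVec,
      ← Matrix.mulVec_transpose, Matrix.mulVec_mulVec, Matrix.mulVec_mulVec, h0,
      Matrix.zero_mulVec, zero_dotProduct]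
  have ht : projMixed h x u *ᵥ v ∈ tangent x u :=
    ⟨projCoord h x u v, pushVec_projCoord h x u v⟩
  have hv : v = normalMixed h x u *ᵥ v + projMixed h x u *ᵥ v := by
    rw [normalMixed, Matrix.sub_mulVec, Matrix.one_mulVec, sub_add_cancel]
  rw [normalPart, dif_pos hc]
  conv_lhs => rw [hv]
  rw [map_add, (Submodule.projection_apply_eq_zero_iff hc).2 ht, add_zero]
  exact Submodule.projection_apply_left hc ⟨_, hn⟩

/-! ### The covariant derivative of the normal projection -/

theorem eventually_isUnit_det_inducedMatrix (hx : ContDiffAt ℝ 2 x u)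
    (hh : ∀ i j, DifferentiableAt ℝ (fun y => h y i j) (x u))
    (hg : IsUnit (inducedMatrix h x u).det) :
    ∀ᶠ v in 𝓝 u, IsUnit (inducedMatrix h x v).det :=
  ((differentiableAt_det (differentiableAt_inducedMatrix hx hh)).continuousAt.eventually_ne
    hg.ne_zero).mono fun _ hv => hv.isUnit

/-- `(∇̄_w Π) eₐ = -Π (∇̄_w eₐ)`. -/
theorem covMixed_normalMixed_mul_frame (hx : ContDiffAt ℝ 2 x u)
    (hh : ∀ i j, DifferentiableAt ℝ (fun y => h y i j) (x u))
    (hg : IsUnit (inducedMatrix h x u).det) (w : Fin n → ℝ) :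
    covMixed h x w (normalMixed h x) u * frame x u =
      -(normalMixed h x u * (dirMat w (frame x) u + connMat h x u w * frame x u)) := by
  have h0 := normalMixed_mul_frame hg
  have h1 := dirMat_mul (w := w) (differentiableAt_normalMixed hx hh hg) (differentiableAt_frame hx)
  -- The product vanishes on a neighbourhood, so its derivative is zero and the product rule trades
  -- `(∂Π) E` for `-Π ∂E`.
  have h2 : (fun v => normalMixed h x v * frame x v) =ᶠ[𝓝 u] fun _ => 0 :=
    (eventually_isUnit_det_inducedMatrix hx hh hg).mono fun v hv => normalMixed_mul_frame hv
  rw [dirMat_congr h2, dirMat_const] at h1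
  rw [covMixed_eq, Matrix.sub_mul, Matrix.add_mul, Matrix.mul_assoc _ _ (frame x u), h0,
    eq_neg_of_add_eq_zero_left h1.symm, Matrix.mul_add, Matrix.mul_zero, Matrix.mul_assoc]
  abel

/-- By the Leibniz rule `∇̄_X (E Y) = (∇̄_X E) Y + E ∂_X Y`. The last term dies under `Π`, and `Π
(∇̄_X E) = -(∇̄_X Π) E`. -/
theorem secondFundamentalForm_eq (hs : ∀ y, (h y).IsSymm) (hx : ContDiffAt ℝ 2 x u)
    (hh : ∀ i j, DifferentiableAt ℝ (fun y => h y i j) (x u))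
    (hg : IsUnit (inducedMatrix h x u).det) (X Y : EuclideanSpace ℝ (Fin n) → Fin n → ℝ)
    (hY : ∀ a, DifferentiableAt ℝ (fun v => Y v a) u) :
    secondFundamentalForm h x X Y u =
      -(covMixed h x (X u) (normalMixed h x) u *ᵥ pushVec x u (Y u)) := by
  rw [secondFundamentalForm, normalPart_eq (hs _) hg, covVec_eq]
  have h1 : (fun i => dirDeriv (X u) (fun v => pushVec x v (Y v) i) u) =
      dirMat (X u) (frame x) u *ᵥ Y u +
        frame x u *ᵥ fun a => dirDeriv (X u) (fun v => Y v a) u := by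
    funext i
    exact dirDeriv_mulVec (differentiableAt_frame hx) hY i
  rw [h1, pushVec, Matrix.mulVec_mulVec, Matrix.mulVec_mulVec,
    covMixed_normalMixed_mul_frame hx hh hg, Matrix.neg_mulVec, neg_neg, Matrix.mulVec_add,
    Matrix.mulVec_add, Matrix.mulVec_mulVec _ _ (frame x u), normalMixed_mul_frame hg,
    Matrix.zero_mulVec, add_zero, ← Matrix.mulVec_add, ← Matrix.add_mulVec, Matrix.mulVec_mulVec]

/-- Both sides equal `-Π` applied to the second derivative of `x` plus the Christoffel term, and
each of these two is symmetric in `w` and `v`. -/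
theorem covMixed_normalMixed_mulVec_comm (hs : ∀ y, (h y).IsSymm) (hx : ContDiffAt ℝ 2 x u)
    (hh : ∀ i j, DifferentiableAt ℝ (fun y => h y i j) (x u))
    (hg : IsUnit (inducedMatrix h x u).det) (w v : Fin n → ℝ) :
    covMixed h x w (normalMixed h x) u *ᵥ pushVec x u v =
      covMixed h x v (normalMixed h x) u *ᵥ pushVec x u w := by
  have key : ∀ w v, covMixed h x w (normalMixed h x) u *ᵥ pushVec x u v =
      -(normalMixed h x u *ᵥ (dirMat w (frame x) u *ᵥ v + connMat h x u w *ᵥ pushVec x u v)) := by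
    intro w v
    rw [pushVec, Matrix.mulVec_mulVec, covMixed_normalMixed_mul_frame hx hh hg, Matrix.neg_mulVec,
      Matrix.mulVec_mulVec, ← Matrix.add_mulVec, Matrix.mulVec_mulVec]
  rw [key, key, dirMat_frame_mulVec_comm hx, connMat_mulVec_pushVec_comm hs]

/-- The identity endomorphism is parallel: its connection terms cancel. -/
theorem covMixed_projMixed (w : Fin n → ℝ) :
    covMixed h x w (projMixed h x) u = -covMixed h x w (normalMixed h x) u := by
  rw [covMixed_eq, covMixed_eq,
    show normalMixed h x = fun v => 1 - projMixed h x v from rfl, dirMat_const_sub]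
  noncomm_ring

theorem covLow_isSymm {T : EuclideanSpace ℝ (Fin n) → Matrix (Fin m) (Fin m) ℝ}
    (hT : ∀ v, (T v).IsSymm) (w : Fin n → ℝ) : (covLow h x w T u).IsSymm := by
  have hd : (dirMat w T u)ᵀ = dirMat w T u := by
    ext i j
    simp only [dirMat, Matrix.transpose_apply, Matrix.of_apply, fun v => (hT v).apply i j]
  rw [Matrix.IsSymm, covLow_eq, Matrix.transpose_sub, Matrix.transpose_sub, Matrix.transpose_mul,
    Matrix.transpose_mul, Matrix.transpose_transpose, (hT u).eq, hd]
  abel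

/-! ### Linearity in the direction, and contraction of `∇̂_j` -/

theorem dirMat_sum_smul {d : ℕ} {p q : Type*} (w : Fin m → Fin d → ℝ) (c : Fin m → ℝ)
    (T : EuclideanSpace ℝ (Fin d) → Matrix p q ℝ) (u : EuclideanSpace ℝ (Fin d)) :
    ∑ j, c j • dirMat (w j) T u = dirMat (∑ j, c j • w j) T u := by
  ext i k
  simp only [Matrix.sum_apply, Matrix.smul_apply, dirMat, Matrix.of_apply, dirDeriv, smul_eq_mul,
    Finset.sum_apply, Pi.smul_apply, Finset.mul_sum, Finset.sum_mul]
  rw [Finset.sum_comm]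
  exact Finset.sum_congr rfl fun a _ => Finset.sum_congr rfl fun b _ => by ring

theorem connMat_sum_smul (w : Fin m → Fin n → ℝ) (c : Fin m → ℝ) :
    ∑ j, c j • connMat h x u (w j) = connMat h x u (∑ j, c j • w j) := by
  ext i k
  simp only [Matrix.sum_apply, Matrix.smul_apply, connMat, Matrix.of_apply, smul_eq_mul, pushVec,
    Matrix.mulVec_sum, Matrix.mulVec_smul, Finset.sum_apply, Pi.smul_apply, Finset.mul_sum]
  rw [Finset.sum_comm]
  exact Finset.sum_congr rfl fun a _ => Finset.sum_congr rfl fun b _ => by ring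

theorem sum_smul_projCoord_single (X : Fin m → ℝ) :
    ∑ j, X j • projCoord h x u (Pi.single j 1) = projCoord h x u X := by
  simp only [projCoord, ← Matrix.mulVec_smul, ← Matrix.mulVec_sum]
  congr 1
  ext j
  simp [Finset.sum_apply, Pi.single_apply]

/-- The covariant derivative is linear in its direction, and `Σ_j Xʲ D(∂_j) = D(X) = X` for tangent
`X`. -/
theorem sum_smul_hatMixed (hg : IsUnit (inducedMatrix h x u).det)
    (T : EuclideanSpace ℝ (Fin n) → Matrix (Fin m) (Fin m) ℝ) (w : Fin n → ℝ) :
    ∑ j, pushVec x u w j • hatMixed h x j T u = covMixed h x w T u := by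
  simp only [hatMixed, covMixed_eq, smul_sub, smul_add, Finset.sum_sub_distrib,
    Finset.sum_add_distrib, ← Matrix.smul_mul, ← Matrix.sum_mul]
  simp only [Matrix.smul_mul, ← Matrix.mul_smul, ← Matrix.mul_sum]
  rw [dirMat_sum_smul, connMat_sum_smul, sum_smul_projCoord_single, projCoord_pushVec hg]

theorem sum_smul_hatLow (hg : IsUnit (inducedMatrix h x u).det)
    (T : EuclideanSpace ℝ (Fin n) → Matrix (Fin m) (Fin m) ℝ) (w : Fin n → ℝ) :
    ∑ j, pushVec x u w j • hatLow h x j T u = covLow h x w T u := by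
  simp only [hatLow, covLow_eq, smul_sub, Finset.sum_sub_distrib,
    ← Matrix.smul_mul, ← Matrix.sum_mul, ← Matrix.transpose_smul, ← Matrix.transpose_sum]
  simp only [Matrix.smul_mul, ← Matrix.mul_smul, ← Matrix.mul_sum]
  rw [dirMat_sum_smul, connMat_sum_smul, sum_smul_projCoord_single, projCoord_pushVec hg]

end Conn

/-! ### Coordinate expressions -/

section Coord

variable {m n : ℕ} {M S : Type*}
  [TopologicalSpace M] [ChartedSpace (EuclideanSpace ℝ (Fin m)) M]
  [TopologicalSpace S] [ChartedSpace (EuclideanSpace ℝ (Fin n)) S]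

theorem mdifferentiable_of_mem_maximalAtlas [IsManifold (𝓡 m) ∞ M]
    {e : OpenPartialHomeomorph M (EuclideanSpace ℝ (Fin m))}
    (he : e ∈ IsManifold.maximalAtlas (𝓡 m) ∞ M) : e.MDifferentiable (𝓡 m) (𝓡 m) :=
  ⟨(contMDiffOn_of_mem_maximalAtlas he).mdifferentiableOn (by simp),
    (contMDiffOn_symm_of_mem_maximalAtlas he).mdifferentiableOn (by simp)⟩

theorem PseudoRiemannianMetric.comp_isSymm (η : PseudoRiemannianMetric m M)
    (e : OpenPartialHomeomorph M (EuclideanSpace ℝ (Fin m))) (y : EuclideanSpace ℝ (Fin m)) :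
    (η.comp e y).IsSymm := by
  ext i j
  exact (η.symm (e.symm y)).eq _ _

/-- A matrix of a bilinear form in a spanning family is invertible if the form is nondegenerate. -/
theorem isUnit_det_of_nondegenerate {d : ℕ} {V : Type*} [AddCommGroup V] [Module ℝ V]
    (b : LinearMap.BilinForm ℝ V) (hb : b.Nondegenerate) (L : EuclideanSpace ℝ (Fin d) ≃ₗ[ℝ] V)
    (A : Matrix (Fin d) (Fin d) ℝ)
    (hA : ∀ i j, A i j = b (L (EuclideanSpace.single i 1)) (L (EuclideanSpace.single j 1))) :
    IsUnit A.det := by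
  let B : Module.Basis (Fin d) ℝ V := (EuclideanSpace.basisFun (Fin d) ℝ).toBasis.map L
  have hAB : A = LinearMap.BilinForm.toMatrix B b := by
    ext i j
    simp [hA, B, LinearMap.BilinForm.toMatrix_apply]
  rw [hAB]
  exact ((LinearMap.BilinForm.nondegenerate_iff_det_ne_zero B).1 hb).isUnit

/-- The coordinate fields are the image of the standard basis under the isomorphism `d(e⁻¹)`, hence
a basis. -/
theorem PseudoRiemannianMetric.isUnit_det_comp [IsManifold (𝓡 m) ∞ M]
    (η : PseudoRiemannianMetric m M) {e : OpenPartialHomeomorph M (EuclideanSpace ℝ (Fin m))}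
    (he : e ∈ IsManifold.maximalAtlas (𝓡 m) ∞ M) {y : EuclideanSpace ℝ (Fin m)}
    (hy : y ∈ e.target) : IsUnit (η.comp e y).det :=
  isUnit_det_of_nondegenerate (η.form (e.symm y)) (η.nondegenerate _)
    ((mdifferentiable_of_mem_maximalAtlas he).symm.mfderiv hy).toLinearEquiv _ fun _ _ => rfl

theorem PseudoRiemannianMetric.differentiableAt_comp
    (η : PseudoRiemannianMetric m M) {e : OpenPartialHomeomorph M (EuclideanSpace ℝ (Fin m))}
    (he : e ∈ IsManifold.maximalAtlas (𝓡 m) ∞ M) {y : EuclideanSpace ℝ (Fin m)}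
    (hy : y ∈ e.target) (i j : Fin m) : DifferentiableAt ℝ (fun z => η.comp e z i j) y :=
  ((η.smooth e he i j).contDiffAt (e.open_target.mem_nhds hy)).differentiableAt (by simp)

variable {f : S → M} {e : OpenPartialHomeomorph M (EuclideanSpace ℝ (Fin m))}
  {c : OpenPartialHomeomorph S (EuclideanSpace ℝ (Fin n))} {u : EuclideanSpace ℝ (Fin n)}

theorem contDiffAt_coordExpr [IsManifold (𝓡 m) ∞ M] [IsManifold (𝓡 n) ∞ S]
    (hf : ContMDiff (𝓡 n) (𝓡 m) ∞ f) (he : e ∈ IsManifold.maximalAtlas (𝓡 m) ∞ M)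
    (hc : c ∈ IsManifold.maximalAtlas (𝓡 n) ∞ S) (hu : u ∈ c.target)
    (hfu : f (c.symm u) ∈ e.source) : ContDiffAt ℝ ∞ (coordExpr f e c) u :=
  ((contMDiffAt_of_mem_maximalAtlas he hfu).comp u
    ((hf (c.symm u)).comp u (contMDiffAt_symm_of_mem_maximalAtlas hc hu))).contDiffAt

theorem sum_frame_smul_single {x : EuclideanSpace ℝ (Fin n) → EuclideanSpace ℝ (Fin m)}
    (hx : DifferentiableAt ℝ x u) (a : Fin n) :
    ∑ i, frame x u i a • EuclideanSpace.single i (1 : ℝ) =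
      fderiv ℝ x u (EuclideanSpace.single a 1) := by
  ext i
  have h1 : fderiv ℝ (fun v => x v i) u = (EuclideanSpace.proj i).comp (fderiv ℝ x u) :=
    ((EuclideanSpace.proj (𝕜 := ℝ) i).hasFDerivAt.comp u hx.hasFDerivAt).fderiv
  simp [frame, pderiv, h1, Pi.single_apply]

/-- The chain rule for `f ∘ c⁻¹ = e⁻¹ ∘ x`. -/
theorem mfderiv_symm_comp_fderiv_coordExpr [IsManifold (𝓡 m) ∞ M] [IsManifold (𝓡 n) ∞ S]
    (hf : ContMDiff (𝓡 n) (𝓡 m) ∞ f) (he : e ∈ IsManifold.maximalAtlas (𝓡 m) ∞ M)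
    (hc : c ∈ IsManifold.maximalAtlas (𝓡 n) ∞ S) (hu : u ∈ c.target)
    (hfu : f (c.symm u) ∈ e.source) (w : EuclideanSpace ℝ (Fin n)) :
    (show EuclideanSpace ℝ (Fin m) from mfderiv (𝓡 m) (𝓡 m) e.symm (coordExpr f e c u)
      (fderiv ℝ (coordExpr f e c) u w)) =
    (show EuclideanSpace ℝ (Fin m) from mfderiv (𝓡 n) (𝓡 m) f (c.symm u)
      (mfderiv (𝓡 n) (𝓡 n) c.symm u w)) := by
  have hx := (contDiffAt_coordExpr hf he hc hu hfu).differentiableAt (by simp)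
  have hcs := (mdifferentiable_of_mem_maximalAtlas hc).mdifferentiableAt_symm hu
  have hes := (mdifferentiable_of_mem_maximalAtlas he).mdifferentiableAt_symm
    (show coordExpr f e c u ∈ e.target from e.map_source hfu)
  have h1 := mfderiv_comp u hes hx.mdifferentiableAt
  have h2 := mfderiv_comp u ((hf (c.symm u)).mdifferentiableAt (by simp)) hcs
  -- The two composites need only agree while `f` stays in `e.source`, which by continuity is a
  -- neighbourhood of `u`.
  have h3 : e.symm ∘ coordExpr f e c =ᶠ[𝓝 u] f ∘ c.symm := by
    have hcont : ContinuousAt (f ∘ c.symm) u :=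
      (hf.continuous.continuousAt).comp (c.continuousAt_symm hu)
    filter_upwards [hcont.preimage_mem_nhds (e.open_source.mem_nhds hfu)] with v hv
    exact e.left_inv hv
  have h4 : HasMFDerivAt (𝓡 n) (𝓡 m) (f ∘ c.symm) u
      (mfderiv (𝓡 n) (𝓡 m) (e.symm ∘ coordExpr f e c) u) :=
    (hes.comp u hx.mdifferentiableAt).hasMFDerivAt.congr_of_eventuallyEq h3.symm
  have h5 := h4.mfderiv
  rw [h1, h2, mfderiv_eq_fderiv] at h5
  exact (DFunLike.congr_fun h5 w).symm

/-- This ties `Eᵀ h E` to the invariant pullback form: by the chain rule `df(∂_a) = Σ_i (∂ₐ xⁱ)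
∂_i`, and bilinearity does the rest. Nondegeneracy of the form thereby becomes invertibility of the
matrix. -/
theorem PseudoRiemannianMetric.inducedMatrix_apply [IsManifold (𝓡 m) ∞ M] [IsManifold (𝓡 n) ∞ S]
    (η : PseudoRiemannianMetric m M)
    (hf : ContMDiff (𝓡 n) (𝓡 m) ∞ f) (he : e ∈ IsManifold.maximalAtlas (𝓡 m) ∞ M)
    (hc : c ∈ IsManifold.maximalAtlas (𝓡 n) ∞ S) (hu : u ∈ c.target)
    (hfu : f (c.symm u) ∈ e.source) (a b : Fin n) :
    inducedMatrix (η.comp e) (coordExpr f e c) u a b =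
      η.induced (n := n) f (c.symm u) (coordVec c a u) (coordVec c b u) := by
  have hx := (contDiffAt_coordExpr hf he hc hu hfu).differentiableAt (by simp)
  set x := coordExpr f e c with hxdef
  have hq : e.symm (x u) = f (c.symm u) := e.left_inv hfu
  have key : ∀ a, (show EuclideanSpace ℝ (Fin m) from
      ∑ i, frame x u i a • coordVec e i (x u)) =
      (show EuclideanSpace ℝ (Fin m) from
        mfderiv (𝓡 n) (𝓡 m) f (c.symm u) (coordVec c a u)) := by
    intro a
    refine Eq.trans ?_ (mfderiv_symm_comp_fderiv_coordExpr hf he hc hu hfu _)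
    rw [← hxdef, ← sum_frame_smul_single hx a]
    exact (map_sum (mfderiv (𝓡 m) (𝓡 m) e.symm (x u)) _ _).symm ▸
      Finset.sum_congr rfl fun i _ => (map_smul (mfderiv (𝓡 m) (𝓡 m) e.symm (x u)) _ _).symm
  -- The base points `e.symm (x u)` and `f (c.symm u)` are only propositionally equal; viewing all
  -- tangent spaces as one Euclidean space allows the base point to be replaced.
  have hform : ∀ p q : M, p = q → ∀ v w : EuclideanSpace ℝ (Fin m),
      (η.form p : LinearMap.BilinForm ℝ (EuclideanSpace ℝ (Fin m))) v w =
        (η.form q : LinearMap.BilinForm ℝ (EuclideanSpace ℝ (Fin m))) v w := by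
    rintro p _ rfl v w
    rfl
  have e1 : inducedMatrix (η.comp e) x u a b =
      η.form (e.symm (x u)) (∑ i, frame x u i a • coordVec e i (x u))
        (∑ j, frame x u j b • coordVec e j (x u)) := by
    simp only [inducedMatrix, Matrix.mul_apply, Matrix.transpose_apply,
      PseudoRiemannianMetric.comp, Matrix.of_apply, map_sum, map_smul, LinearMap.sum_apply,
      LinearMap.smul_apply, smul_eq_mul, Finset.sum_mul, Finset.mul_sum]
    exact Finset.sum_congr rfl fun i _ => Finset.sum_congr rfl fun j _ => by ring
  rw [e1]
  refine (hform _ _ hq _ _).trans ?_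
  exact congrArg₂ (fun v w : EuclideanSpace ℝ (Fin m) =>
    (η.form (f (c.symm u)) : LinearMap.BilinForm ℝ (EuclideanSpace ℝ (Fin m))) v w) (key a) (key b)

theorem PseudoRiemannianMetric.isUnit_det_inducedMatrix [IsManifold (𝓡 m) ∞ M]
    [IsManifold (𝓡 n) ∞ S] (η : PseudoRiemannianMetric m M)
    (hf : ContMDiff (𝓡 n) (𝓡 m) ∞ f) (he : e ∈ IsManifold.maximalAtlas (𝓡 m) ∞ M)
    (hc : c ∈ IsManifold.maximalAtlas (𝓡 n) ∞ S) (hu : u ∈ c.target)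
    (hfu : f (c.symm u) ∈ e.source)
    (hg : (η.induced (n := n) f (c.symm u)).Nondegenerate) :
    IsUnit (inducedMatrix (η.comp e) (coordExpr f e c) u).det :=
  isUnit_det_of_nondegenerate (η.induced f (c.symm u)) hg
    ((mdifferentiable_of_mem_maximalAtlas hc).symm.mfderiv hu).toLinearEquiv _
    (η.inducedMatrix_apply hf he hc hu hfu)

/-- On `c.target` the components are those of the pullback of `X` along `c.symm`, and pullback by a
local diffeomorphism preserves smoothness up to one lost derivative. -/
theorem differentiableAt_coordComp [IsManifold (𝓡 n) ∞ S]
    (hc : c ∈ IsManifold.maximalAtlas (𝓡 n) ∞ S) (hu : u ∈ c.target)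
    {X : ∀ p : S, TangentSpace (𝓡 n) p}
    (hX : ContMDiffAt (𝓡 n) (𝓡 n).tangent ∞ (fun p => (⟨p, X p⟩ : TangentBundle (𝓡 n) S))
      (c.symm u)) (a : Fin n) :
    DifferentiableAt ℝ (fun v => coordComp c X v a) u := by
  have hcm := mdifferentiable_of_mem_maximalAtlas hc
  have : IsManifold (𝓡 n) 1 S := IsManifold.of_le (n := ∞) (by simp)
  have h1 : ContMDiffAt (𝓡 n) (𝓡 n).tangent 1
      (fun v => (⟨v, VectorField.mpullback (𝓡 n) (𝓡 n) c.symm X v⟩ :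
        TangentBundle (𝓡 n) (EuclideanSpace ℝ (Fin n)))) u :=
    ContMDiffAt.mpullback_vectorField_preimage (n := ∞) (hX.of_le (by simp))
      (contMDiffAt_symm_of_mem_maximalAtlas hc hu) ⟨hcm.symm.mfderiv hu, rfl⟩
      (by norm_cast)
  have h2 := (contMDiffAt_vectorSpace_iff_contDiffAt.1 h1).differentiableAt (by simp)
  have h3 : (fun v => coordComp c X v a) =ᶠ[𝓝 u] fun v =>
      (show EuclideanSpace ℝ (Fin n) from VectorField.mpullback (𝓡 n) (𝓡 n) c.symm X v) a := by
    filter_upwards [c.open_target.mem_nhds hu] with v hv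
    have hinv : (mfderiv (𝓡 n) (𝓡 n) c.symm v).inverse =
        (hcm.symm.mfderiv hv).symm := ContinuousLinearMap.inverse_equiv (hcm.symm.mfderiv hv)
    simp only [VectorField.mpullback_apply, hinv]
    rfl
  refine DifferentiableAt.congr_of_eventuallyEq ?_ h3
  exact (EuclideanSpace.proj (𝕜 := ℝ) a).differentiableAt.comp u h2

end Coord

/-! ### Contractions -/

section Contraction

variable {m n : ℕ} {h : EuclideanSpace ℝ (Fin m) → Matrix (Fin m) (Fin m) ℝ}
  {x : EuclideanSpace ℝ (Fin n) → EuclideanSpace ℝ (Fin m)} {u : EuclideanSpace ℝ (Fin n)}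

theorem sum_sum_mul_eq_mulVec (A : Fin m → Matrix (Fin m) (Fin m) ℝ) (X Y : Fin m → ℝ)
    (i : Fin m) : ∑ j, ∑ k, A j i k * X j * Y k = ((∑ j, X j • A j) *ᵥ Y) i := by
  simp only [Matrix.mulVec, dotProduct, Matrix.sum_apply, Matrix.smul_apply, smul_eq_mul,
    Finset.sum_mul]
  rw [Finset.sum_comm]
  exact Finset.sum_congr rfl fun k _ => Finset.sum_congr rfl fun j _ => by ring

theorem sum_mul_sum_contract (P Q : Fin m → Fin m → Fin m → ℝ) :
    ∑ i, ∑ j, ∑ k, ∑ l, ∑ r, P r i j * Q r k l =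
      ∑ r, (∑ i, ∑ j, P r i j) * ∑ k, ∑ l, Q r k l := by
  refine ((Finset.sum_congr rfl fun i _ => (Finset.sum_congr rfl fun j _ =>
    (Finset.sum_congr rfl fun k _ => Finset.sum_comm).trans Finset.sum_comm).trans
      Finset.sum_comm).trans Finset.sum_comm).trans (Finset.sum_congr rfl fun r _ => ?_)
  simp_rw [Finset.sum_mul, Finset.mul_sum]

theorem covLow_normalLow (hs : ∀ y, (h y).IsSymm) (hd : IsUnit (h (x u)).det)
    (hx : ContDiffAt ℝ 2 x u) (hh : ∀ i j, DifferentiableAt ℝ (fun y => h y i j) (x u))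
    (hg : IsUnit (inducedMatrix h x u).det) (w : Fin n → ℝ) :
    covLow h x w (normalLow h x) u = h (x u) * covMixed h x w (normalMixed h x) u :=
  covLow_metric_mul hs hd hh (hx.differentiableAt (by norm_num))
    (differentiableAt_normalMixed hx hh hg) w

theorem covLow_projLow (hs : ∀ y, (h y).IsSymm) (hd : IsUnit (h (x u)).det)
    (hx : ContDiffAt ℝ 2 x u) (hh : ∀ i j, DifferentiableAt ℝ (fun y => h y i j) (x u))
    (hg : IsUnit (inducedMatrix h x u).det) (w : Fin n → ℝ) :
    covLow h x w (projLow h x) u = -(h (x u) * covMixed h x w (normalMixed h x) u) := by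
  have hlow : projLow h x = fun v => h (x v) * projMixed h x v := by
    funext v
    rw [projLow, projMixed, Matrix.mul_assoc]
  rw [hlow, covLow_metric_mul hs hd hh (hx.differentiableAt (by norm_num))
    (differentiableAt_projMixed hx hh hg), covMixed_projMixed, Matrix.mul_neg]

theorem secondFundamentalForm_eq_hatMixed (hs : ∀ y, (h y).IsSymm) (hx : ContDiffAt ℝ 2 x u)
    (hh : ∀ i j, DifferentiableAt ℝ (fun y => h y i j) (x u))
    (hg : IsUnit (inducedMatrix h x u).det) (X Y : EuclideanSpace ℝ (Fin n) → Fin n → ℝ)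
    (hY : ∀ a, DifferentiableAt ℝ (fun v => Y v a) u) (i : Fin m) :
    secondFundamentalForm h x X Y u i = -∑ j, ∑ k, hatMixed h x j (normalMixed h x) u i k *
      pushVec x u (X u) j * pushVec x u (Y u) k := by
  rw [sum_sum_mul_eq_mulVec (fun j => hatMixed h x j (normalMixed h x) u), sum_smul_hatMixed hg,
    secondFundamentalForm_eq hs hx hh hg X Y hY, Pi.neg_apply]

/-- Two copies of the formula for `α`, whose signs cancel. The metric contracting them is absorbed
in the first factor, since `∇̄_w` commutes with lowering an index. -/
theorem inner_secondFundamentalForm (hs : ∀ y, (h y).IsSymm) (hd : IsUnit (h (x u)).det)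
    (hx : ContDiffAt ℝ 2 x u) (hh : ∀ i j, DifferentiableAt ℝ (fun y => h y i j) (x u))
    (hg : IsUnit (inducedMatrix h x u).det) (X Y Z V : EuclideanSpace ℝ (Fin n) → Fin n → ℝ)
    (hY : ∀ a, DifferentiableAt ℝ (fun v => Y v a) u)
    (hV : ∀ a, DifferentiableAt ℝ (fun v => V v a) u) :
    ∑ i, ∑ j, h (x u) i j * secondFundamentalForm h x X Y u i *
        secondFundamentalForm h x Z V u j =
      ∑ i, ∑ j, ∑ k, ∑ l, ∑ r,
        hatLow h x i (normalLow h x) u r j * hatMixed h x k (normalMixed h x) u r l *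
          pushVec x u (X u) i * pushVec x u (Y u) j * pushVec x u (Z u) k *
          pushVec x u (V u) l := by
  have e1 : ∑ i, ∑ j, ∑ k, ∑ l, ∑ r,
        hatLow h x i (normalLow h x) u r j * hatMixed h x k (normalMixed h x) u r l *
          pushVec x u (X u) i * pushVec x u (Y u) j * pushVec x u (Z u) k *
          pushVec x u (V u) l =
      ∑ i, ∑ j, ∑ k, ∑ l, ∑ r,
        (hatLow h x i (normalLow h x) u r j * pushVec x u (X u) i * pushVec x u (Y u) j) *
        (hatMixed h x k (normalMixed h x) u r l * pushVec x u (Z u) k * pushVec x u (V u) l) := by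
    refine Finset.sum_congr rfl fun i _ => Finset.sum_congr rfl fun j _ =>
      Finset.sum_congr rfl fun k _ => Finset.sum_congr rfl fun l _ =>
      Finset.sum_congr rfl fun r _ => ?_
    ring
  rw [e1, sum_mul_sum_contract
    (fun r i j => hatLow h x i (normalLow h x) u r j * pushVec x u (X u) i * pushVec x u (Y u) j)
    fun r k l => hatMixed h x k (normalMixed h x) u r l * pushVec x u (Z u) k *
      pushVec x u (V u) l]
  simp only [sum_sum_mul_eq_mulVec fun j => hatMixed h x j (normalMixed h x) u,
    sum_sum_mul_eq_mulVec fun j => hatLow h x j (normalLow h x) u, sum_smul_hatMixed hg,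
    sum_smul_hatLow hg, covLow_normalLow hs hd hx hh hg, secondFundamentalForm_eq hs hx hh hg X Y hY,
    secondFundamentalForm_eq hs hx hh hg Z V hV, ← Matrix.mulVec_mulVec]
  -- The outer index becomes that of `α(Z, V)`, matching the contracted index `r` on the right.
  rw [Finset.sum_comm]
  refine Finset.sum_congr rfl fun r _ => ?_
  rw [Matrix.mulVec, dotProduct, Finset.sum_mul]
  refine Finset.sum_congr rfl fun j _ => ?_
  rw [(hs (x u)).apply r j, Pi.neg_apply, Pi.neg_apply]
  ring

/-- The Codazzi-type symmetry of `∇̂ 𝒟`. -/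
theorem sum_hatLow_projLow_sub (hs : ∀ y, (h y).IsSymm) (hd : IsUnit (h (x u)).det)
    (hx : ContDiffAt ℝ 2 x u) (hh : ∀ i j, DifferentiableAt ℝ (fun y => h y i j) (x u))
    (hg : IsUnit (inducedMatrix h x u).det) (w v : Fin n → ℝ) (k : Fin m) :
    ∑ i, ∑ j, pushVec x u w i * pushVec x u v j *
      (hatLow h x i (projLow h x) u j k - hatLow h x j (projLow h x) u i k) = 0 := by
  -- The derivative of the symmetric tensor `D_{jk}` is symmetric; this moves the free index `k` to
  -- the row, so that both contractions become matrix-vector products.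
  have hsym : ∀ i j k, hatLow h x i (projLow h x) u j k = hatLow h x i (projLow h x) u k j :=
    fun i j k => (covLow_isSymm (fun v => projLow_isSymm (hs (x v))) _).apply k j
  have key : ∀ w v : Fin n → ℝ,
      ∑ i, ∑ j, hatLow h x i (projLow h x) u k j * pushVec x u w i * pushVec x u v j =
        -(h (x u) *ᵥ (covMixed h x w (normalMixed h x) u *ᵥ pushVec x u v)) k := by
    intro w v
    rw [sum_sum_mul_eq_mulVec fun j => hatLow h x j (projLow h x) u, sum_smul_hatLow hg,
      covLow_projLow hs hd hx hh hg, Matrix.neg_mulVec, Matrix.mulVec_mulVec, Pi.neg_apply]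
  have e1 : ∑ i, ∑ j, pushVec x u w i * pushVec x u v j *
        (hatLow h x i (projLow h x) u j k - hatLow h x j (projLow h x) u i k) =
      ∑ i, ∑ j, hatLow h x i (projLow h x) u k j * pushVec x u w i * pushVec x u v j -
        ∑ j, ∑ i, hatLow h x j (projLow h x) u k i * pushVec x u v j * pushVec x u w i := by
    rw [Finset.sum_comm (f := fun j i =>
      hatLow h x j (projLow h x) u k i * pushVec x u v j * pushVec x u w i)]
    simp only [← Finset.sum_sub_distrib]
    refine Finset.sum_congr rfl fun i _ => Finset.sum_congr rfl fun j _ => ?_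
    rw [hsym i j k, hsym j i k]
    ring
  rw [e1, key, key, covMixed_normalMixed_mulVec_comm hs hx hh hg w v, sub_self]

end Contraction

end PseudoRiemannianSubmanifold

end

/-! ### Assembly in a pair of charts -/

theorem mainTheorem2 {m n : ℕ} {M S : Type*}
    [TopologicalSpace M] [ChartedSpace (EuclideanSpace ℝ (Fin m)) M] [IsManifold (𝓡 m) ∞ M]
    [TopologicalSpace S] [ChartedSpace (EuclideanSpace ℝ (Fin n)) S] [IsManifold (𝓡 n) ∞ S]
    (η : PseudoRiemannianMetric m M)
    (f : S → M) (hf : ContMDiff (𝓡 n) (𝓡 m) ∞ f) (hg : ∀ p : S, (η.induced (n := n) f p).Nondegenerate)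
    (e : OpenPartialHomeomorph M (EuclideanSpace ℝ (Fin m)))
    (he : e ∈ IsManifold.maximalAtlas (𝓡 m) ∞ M)
    (c : OpenPartialHomeomorph S (EuclideanSpace ℝ (Fin n)))
    (hc : c ∈ IsManifold.maximalAtlas (𝓡 n) ∞ S)
    (h : EuclideanSpace ℝ (Fin m) → Matrix (Fin m) (Fin m) ℝ) (hh : h = η.comp e)
    (x : EuclideanSpace ℝ (Fin n) → EuclideanSpace ℝ (Fin m)) (hx : x = coordExpr f e c)
    (u : EuclideanSpace ℝ (Fin n)) (hu : u ∈ c.target) (hfu : f (c.symm u) ∈ e.source) :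
    (∀ X Y Z V : ∀ p : S, TangentSpace (𝓡 n) p,
      ContMDiffAt (𝓡 n) (𝓡 n).tangent ∞ (fun p => (⟨p, X p⟩ : TangentBundle (𝓡 n) S)) (c.symm u) →
      ContMDiffAt (𝓡 n) (𝓡 n).tangent ∞ (fun p => (⟨p, Y p⟩ : TangentBundle (𝓡 n) S)) (c.symm u) →
      ContMDiffAt (𝓡 n) (𝓡 n).tangent ∞ (fun p => (⟨p, Z p⟩ : TangentBundle (𝓡 n) S)) (c.symm u) →
      ContMDiffAt (𝓡 n) (𝓡 n).tangent ∞ (fun p => (⟨p, V p⟩ : TangentBundle (𝓡 n) S)) (c.symm u) →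
      ∀ X' Y' Z' V' : Fin m → ℝ,
        X' = pushVec x u (coordComp c X u) → Y' = pushVec x u (coordComp c Y u) →
        Z' = pushVec x u (coordComp c Z u) → V' = pushVec x u (coordComp c V u) →
        (∀ i, secondFundamentalForm h x (coordComp c X) (coordComp c Y) u i =
          -∑ j, ∑ k, hatMixed h x j (normalMixed h x) u i k * X' j * Y' k) ∧
        (∑ i, ∑ j, h (x u) i j *
            secondFundamentalForm h x (coordComp c X) (coordComp c Y) u i *
            secondFundamentalForm h x (coordComp c Z) (coordComp c V) u j =
          ∑ i, ∑ j, ∑ k, ∑ l, ∑ r,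
            hatLow h x i (normalLow h x) u r j * hatMixed h x k (normalMixed h x) u r l *
              X' i * Y' j * Z' k * V' l) ∧
        (∀ k, ∑ i, ∑ j, X' i * Y' j *
          (hatLow h x i (projLow h x) u j k - hatLow h x j (projLow h x) u i k) = 0)) ∧
    (∀ (N : ℕ) (B : DerivationBracket N n S) (ε : ℝ) (γ : C^∞⟮𝓡 n, S; ℝ⟯),
      (ε = 1 ∨ ε = -1) → (∀ p, 0 < γ p) → B.Compatible η f ε γ →
      ∀ F : Fin m → C^∞⟮𝓡 n, S; ℝ⟯, (∀ᶠ q in 𝓝 (c.symm u), ∀ i, F i q = e (f q) i) →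
        ∀ i j, projUp h x u i j = ε / γ (c.symm u) ^ 2 * B.square F (h (x u)) (c.symm u) i j) := by
  -- Symmetry holds for every `y`, even off `e.target`; invertibility and differentiability are
  -- obtained only at `x u`, which lies in the target.
  have hs : ∀ y, (h y).IsSymm := hh ▸ η.comp_isSymm e
  have hxu : x u ∈ e.target := hx ▸ e.map_source hfu
  have hd : IsUnit (h (x u)).det := hh ▸ η.isUnit_det_comp he hxu
  have hhd : ∀ i j, DifferentiableAt ℝ (fun y => h y i j) (x u) :=
    hh ▸ η.differentiableAt_comp he hxu
  -- Order two suffices: it gives a differentiable frame and symmetric second derivatives.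
  have hx2 : ContDiffAt ℝ 2 x u :=
    (hx ▸ contDiffAt_coordExpr hf he hc hu hfu : ContDiffAt ℝ ∞ x u).of_le (by norm_cast)
  have hgu : IsUnit (inducedMatrix h x u).det := by
    rw [hh, hx]
    exact η.isUnit_det_inducedMatrix hf he hc hu hfu (hg _)
  refine ⟨?_, ?_⟩
  · rintro X Y Z V - hY - hV X' Y' Z' V' rfl rfl rfl rfl
    have hY' := differentiableAt_coordComp hc hu hY
    have hV' := differentiableAt_coordComp hc hu hV
    exact ⟨secondFundamentalForm_eq_hatMixed hs hx2 hhd hgu _ _ hY',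
      inner_secondFundamentalForm hs hd hx2 hhd hgu _ _ _ _ hY' hV',
      sum_hatLow_projLow_sub hs hd hx2 hhd hgu _ _⟩
  · intro N B ε γ hε hγ hB F hF i j
    have hsq := hB e he c hc u hu hfu F hF i j
    rw [← hh, ← hx] at hsq
    rw [hsq]
    have hγ0 := (hγ (c.symm u)).ne'
    -- The sign is its own inverse, so `ε / γ²` undoes the factor `ε γ²`.
    have hε2 : ε * ε = 1 := by rcases hε with rfl | rfl <;> norm_num
    rw [show ε / γ (c.symm u) ^ 2 * (ε * γ (c.symm u) ^ 2 * projUp h x u i j) =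
      ε * ε * (γ (c.symm u) ^ 2 / γ (c.symm u) ^ 2) * projUp h x u i j by ring, hε2,
      div_self (pow_ne_zero 2 hγ0), one_mul, one_mul]
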